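/- Let $\Gamma\subseteq\mathrm{PSL}_2(\mathbb{R})$ be a Fuchsian subgroup, i.e. a discrete subgroup, acting by fractional linear transformations on the upper half-plane $\mathbb{H}$, and assume that $\Gamma$ is cocompact, i.e. that the quotient $M=\Gamma\backslash\mathbb{H}$ is compact. For an integer $k\ge 1$ let $\mathcal{S}_{2k}^{\Gamma}$ be the complex vector space of cusp forms of weight $2k$ for $\Gamma$, i.e. of holomorphic functions $f:\mathbb{H}\to\mathbb{C}$ with $f(\gamma z)=(cz+d)^{2k}f(z)$ for all $\gamma=\begin{pmatrix}a&b\\c&d\end{pmatrix}\in\Gamma$ that vanish at all cusps of $\Gamma$, equipped with the Petersson inner product $$\langle f_1,f_2\rangle=\int_{M}f_1(z)\overline{f_2(z)}\,y^{2k}\,\frac{dx\,dy}{y^2},\qquad z=x+iy,$$ the integral over $M$ being taken over a (measurable) fundamental domain of $\Gamma$; such a domain exists. Then there is a constant $C_\Gamma$, depending only on $\Gamma$, such that for every $k\ge 1$: the space $\mathcal{S}_{2k}^{\Gamma}$ has a finite orthonormal basis, and for every orthonormal basis $f_1,\dots,f_d$ of $\mathcal{S}_{2k}^{\Gamma}$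 the function $$S_k^{\Gamma}(z)=\sum_{j=1}^{d}|f_j(z)|^2\,\mathrm{Im}(z)^{2k}$$ is bounded on $\mathbb{H}$ (equivalently on $M$), with $$\sup_{z\in M}S_k^{\Gamma}(z)\le C_\Gamma\,k.$$ -/

import Mathlib

open MeasureTheory
open scoped MatrixGroups UpperHalfPlane

noncomputable section

namespace Fuchsian

/-- The action of `PSL(2, ℝ)` on the upper half-plane by fractional linear transformations, as a
homomorphism to the permutations of `ℍ`: the action of `SL(2, ℝ)` factors through the quotient by
the centre. -/
def pslToPerm : PSL(2, ℝ) →* Equiv.Perm ℍ :=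
  QuotientGroup.lift (Subgroup.center SL(2, ℝ)) (MulAction.toPermHom SL(2, ℝ) ℍ) (by
    intro g hg
    obtain ⟨r, hr, hg'⟩ := Matrix.SpecialLinearGroup.mem_center_iff.mp hg
    have h00 : g 0 0 = r := by
      have := congrFun (congrFun hg' 0) 0
      simpa using this.symm
    have h01 : g 0 1 = 0 := by
      have := congrFun (congrFun hg' 0) 1
      simpa using this.symm
    have h10 : g 1 0 = 0 := by
      have := congrFun (congrFun hg' 1) 0
      simpa using this.symm
    have h11 : g 1 1 = r := by
      have := congrFun (congrFun hg' 1) 1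
      simpa using this.symm
    have hr0 : (r : ℂ) ≠ 0 := by
      rintro h
      have : r = 0 := by exact_mod_cast h
      simp [this] at hr
    ext z
    simp [UpperHalfPlane.coe_specialLinearGroup_apply, h00, h01, h10, h11, hr0])

instance pslMulAction : MulAction PSL(2, ℝ) ℍ :=
  MulAction.compHom ℍ pslToPerm

theorem psl_mk_smul (g : SL(2, ℝ)) (z : ℍ) : (g : PSL(2, ℝ)) • z = g • z := rfl

/-- A Fuchsian subgroup of `PSL(2, ℝ)`: a subgroup that is discrete for the quotient topology
of `PSL(2, ℝ) = SL(2, ℝ) / {±1}`. -/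
def IsFuchsian (Γ : Subgroup PSL(2, ℝ)) : Prop := DiscreteTopology Γ

/-- `Γ` is cocompact: the quotient space `M = Γ \ ℍ` is compact. -/
def IsCocompact (Γ : Subgroup PSL(2, ℝ)) : Prop :=
  CompactSpace (MulAction.orbitRel.Quotient Γ ℍ)

/-- The group of all real matrices of determinant one that represent elements of `Γ`. -/
def matrixLift (Γ : Subgroup PSL(2, ℝ)) : Subgroup (GL (Fin 2) ℝ) :=
  (Γ.comap (QuotientGroup.mk' (Subgroup.center SL(2, ℝ)))).map Matrix.SpecialLinearGroup.toGL

instance matrixLift_hasDetOne (Γ : Subgroup PSL(2, ℝ)) : (matrixLift Γ).HasDetOne :=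
  inferInstanceAs (Subgroup.HasDetOne (Subgroup.map Matrix.SpecialLinearGroup.toGL _))

/-- The complex vector space of cusp forms of weight `2k` for `Γ`: holomorphic functions `f` on
`ℍ` with `f (γ z) = (c z + d) ^ (2k) f z` for all matrices representing elements of `Γ`, vanishing
at all cusps of `Γ`. -/
abbrev CuspForms (Γ : Subgroup PSL(2, ℝ)) (k : ℕ) : Type := CuspForm (matrixLift Γ) (2 * (k : ℤ))

/-- The Petersson inner product `∫_M f₁ conj(f₂) y ^ (2k) dμ_hyp`, the integral over
`M = Γ \ ℍ` being computed over a fundamental domain `D` of `Γ`. The measure `volume` on `ℍ` is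
`dx dy / y ^ 2`. -/
def peterssonInner {Γ : Subgroup PSL(2, ℝ)} {k : ℕ} (D : Set ℍ) (f₁ f₂ : CuspForms Γ k) : ℂ :=
  ∫ z in D, f₁ z * (starRingEnd ℂ) (f₂ z) * ((z.im : ℝ) : ℂ) ^ (2 * k)

/-- `f₁, …, f_d` is an orthonormal basis of the space of cusp forms of weight `2k` with respect to
the Petersson inner product. -/
structure IsPeterssonONB {Γ : Subgroup PSL(2, ℝ)} {k : ℕ} (D : Set ℍ) {d : ℕ}
    (f : Fin d → CuspForms Γ k) : Prop where
  orthonormal : ∀ i j, peterssonInner D (f i) (f j) = if i = j then 1 else 0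
  span_eq_top : Submodule.span ℂ (Set.range f) = ⊤

/-- `S_k^Γ(z) = ∑ⱼ |fⱼ(z)|² Im(z) ^ (2k)`, for a finite family `f₁, …, f_d`. -/
def supSum {Γ : Subgroup PSL(2, ℝ)} {k d : ℕ} (f : Fin d → CuspForms Γ k) (z : ℍ) : ℝ :=
  ∑ j, ‖f j z‖ ^ 2 * z.im ^ (2 * k)

end Fuchsian

end

/-! By Bessel's inequality, `S_k(z)` is at most the squared norm of the functional
`f ↦ Im(z) ^ k f(z)` on the Petersson space, so it suffices to bound `|f(z₀)|² Im(z₀) ^ (2k)` by a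
multiple of `k ‖f‖²`, uniformly in `z₀`. On a Euclidean disc about `z₀` of radius comparable with
`Im(z₀) / √k`, the weight `Im(z) ^ (2k)` agrees up to a bounded factor with the square absolute
value of a nonvanishing holomorphic function; absorbing that function into `f`, the mean value
property over the disc, whose hyperbolic area is of order `1 / k`, bounds the value at `z₀` by a
multiple of `k` times the integral of `|f|² Im ^ (2k)` over the hyperbolic unit ball. By proper
discontinuity and cocompactness every orbit meets a unit ball in a bounded number of elements of
`Γ`, so that integral is at most a constant times the integral over a fundamental domain.
Integrating Bessel's inequality over the domain bounds the length of orthonormal families, whence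
finite dimensionality.

A fundamental domain consists of the points nearest to a base point in their orbit, as for
Dirichlet polygons, with ties broken by a measurable injection into `ℝ`. -/

open Set Metric
open scoped ENNReal Manifold Real

section ProperAction

theorem isClosed_center (G : Type*) [Group G] [TopologicalSpace G] [ContinuousMul G] [T2Space G] :
    IsClosed (Subgroup.center G : Set G) := by
  rw [Subgroup.coe_center, ← centralizer_univ]
  exact isClosed_centralizer univ

theorem properSMul_of_isOpenQuotientMap {G Q X : Type*} [Group G] [Group Q] [MulAction G X]
    [MulAction Q X] [TopologicalSpace G] [TopologicalSpace Q] [TopologicalSpace X] [ProperSMul G X]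
    {q : G → Q} (hq : IsOpenQuotientMap q) (hsmul : ∀ g (x : X), q g • x = g • x) :
    ProperSMul Q X where
  isProperMap_smul_pair := by
    have hlift : (fun p : Q × X ↦ (p.1 • p.2, p.2)) ∘ Prod.map q id = fun p ↦ (p.1 • p.2, p.2) :=
      funext fun p ↦ by simp [hsmul]
    have hquot : IsOpenQuotientMap (Prod.map q (id : X → X)) := hq.prodMap .id
    have hproper : IsProperMap fun p : G × X ↦ (p.1 • p.2, p.2) :=
      ProperSMul.isProperMap_smul_pair
    exact isProperMap_of_comp_of_surj hquot.continuous
      (hquot.continuous_comp_iff.mp (hlift ▸ hproper.continuous)) (hlift ▸ hproper) hquot.surjective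

end ProperAction

section IsometricAction

variable {G X : Type*} [Group G] [MulAction G X]

theorem exists_forall_exists_smul_mem_closedBall [PseudoMetricSpace X] [ContinuousConstSMul G X]
    [CompactSpace (MulAction.orbitRel.Quotient G X)] (x₀ : X) :
    ∃ R : ℝ, ∀ x : X, ∃ g : G, g • x ∈ closedBall x₀ R := by
  let q : X → MulAction.orbitRel.Quotient G X := Quotient.mk _
  have hq : IsOpenMap q := isOpenMap_quotient_mk'_mul
  have hcover : univ ⊆ ⋃ n : ℕ, q '' ball x₀ n := by
    rw [← image_iUnion, iUnion_ball_nat, image_univ, Quotient.mk_surjective.range_eq]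
  have hmono : Monotone fun n : ℕ ↦ q '' ball x₀ n := fun m n h ↦
    image_mono (ball_subset_ball (by exact_mod_cast h))
  obtain ⟨n, hn⟩ := isCompact_univ.elim_directed_cover _ (fun n ↦ hq _ isOpen_ball) hcover
    hmono.directed_le
  refine ⟨n, fun x ↦ ?_⟩
  obtain ⟨y, hy, hyx⟩ := hn (mem_univ (q x))
  obtain ⟨g, rfl⟩ := MulAction.orbitRel_apply.mp (Quotient.exact hyx)
  exact ⟨g, ball_subset_closedBall hy⟩

theorem exists_forall_norm_le_of_smul_invariant {E : Type*} [SeminormedAddCommGroup E]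
    [TopologicalSpace X] [CompactSpace (MulAction.orbitRel.Quotient G X)] {F : X → E}
    (hF : Continuous F) (hinv : ∀ (g : G) x, F (g • x) = F x) : ∃ B, ∀ x, ‖F x‖ ≤ B := by
  let F' : MulAction.orbitRel.Quotient G X → E :=
    Quotient.lift F fun x y hxy ↦ by
      obtain ⟨g, rfl⟩ := MulAction.orbitRel_apply.mp hxy
      exact hinv g y
  obtain ⟨B, hB⟩ := isCompact_univ.exists_bound_of_continuousOn (f := F')
    (hF.quotient_lift _).continuousOn
  exact ⟨B, fun x ↦ hB (Quotient.mk _ x) (mem_univ _)⟩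

variable [PseudoMetricSpace X] [ProperSpace X] [ProperlyDiscontinuousSMul G X]

theorem finite_setOf_smul_mem_closedBall (x y : X) (r : ℝ) :
    {g : G | g • x ∈ closedBall y r}.Finite := by
  refine (ProperlyDiscontinuousSMul.finite_disjoint_inter_image (Γ := G) isCompact_singleton
    (isCompact_closedBall y r) (K := {x})).subset fun g hg ↦ ?_
  exact ⟨g • x, mem_image_of_mem _ rfl, hg⟩

variable (G X) in
theorem countable_of_properlyDiscontinuousSMul [Nonempty X] : Countable G := by
  let x : X := Classical.arbitrary X
  refine countable_univ_iff.mp ((countable_iUnion fun n : ℕ ↦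
    (finite_setOf_smul_mem_closedBall (G := G) x x n).countable).mono fun g _ ↦ ?_)
  obtain ⟨n, hn⟩ := exists_nat_ge (dist (g • x) x)
  exact mem_iUnion.mpr ⟨n, hn⟩

variable (G X) in
theorem exists_forall_encard_smul_mem_closedBall_le [IsIsometricSMul G X]
    [CompactSpace (MulAction.orbitRel.Quotient G X)] (r : ℝ) :
    ∃ N : ℕ, ∀ x y : X, {g : G | g • x ∈ closedBall y r}.encard ≤ N := by
  rcases isEmpty_or_nonempty X with _ | ⟨⟨x₀⟩⟩
  · exact ⟨0, fun x ↦ isEmptyElim x⟩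
  obtain ⟨R, hR⟩ := exists_forall_exists_smul_mem_closedBall (G := G) x₀
  set K := closedBall x₀ (R + r)
  have hK : IsCompact K := isCompact_closedBall x₀ (R + r)
  have hfin := ProperlyDiscontinuousSMul.finite_disjoint_inter_image (Γ := G) hK hK
  refine ⟨hfin.toFinset.card, fun x y ↦ ?_⟩
  obtain ⟨h, hh⟩ := hR y
  have hmem {g : G} (hg : g • x ∈ closedBall y r) : h • g • x ∈ K :=
    calc dist (h • g • x) x₀ ≤ dist (h • g • x) (h • y) + dist (h • y) x₀ := dist_triangle _ _ _
      _ ≤ r + R := add_le_add ((dist_smul h _ _).trans_le hg) hh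
      _ = R + r := add_comm r R
  rcases eq_empty_or_nonempty {g : G | g • x ∈ closedBall y r} with hempty | ⟨g₁, hg₁⟩
  · rw [hempty, encard_empty]
    exact zero_le
  rw [← hfin.encard_eq_coe_toFinset_card]
  refine encard_le_encard_of_injOn (f := fun g ↦ h * g * g₁⁻¹ * h⁻¹) (fun g hg ↦ ?_)
    fun a _ b _ hab ↦ by simpa using hab
  exact ⟨h • g • x, ⟨h • g₁ • x, hmem hg₁, by simp [mul_smul]⟩, hmem hg⟩

end IsometricAction

section FundamentalDomain

section Unfolding

variable {G X : Type*} [Group G] [MulAction G X] [MeasurableSpace X] [Countable G]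
  [MeasurableConstSMul G X] {μ : Measure X} [SMulInvariantMeasure G X μ] {D s : Set X}

theorem setLIntegral_eq_setLIntegral_encard_mul (hD : IsFundamentalDomain G D μ)
    (hs : MeasurableSet s) {F : X → ℝ≥0∞} (hF : Measurable F)
    (hinv : ∀ (g : G) x, F (g • x) = F x) :
    ∫⁻ x in s, F x ∂μ = ∫⁻ x in D, {g : G | g • x ∈ s}.encard * F x ∂μ := by
  rw [← lintegral_indicator hs, hD.lintegral_eq_tsum'', ← lintegral_tsum
    (f := fun (g : G) x ↦ s.indicator F (g • x))
    fun g ↦ ((hF.indicator hs).comp (measurable_const_smul g)).aemeasurable]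
  refine lintegral_congr fun x ↦ ?_
  calc ∑' g : G, s.indicator F (g • x)
      = ∑' g : G, {g : G | g • x ∈ s}.indicator (fun _ ↦ F x) g := by
        exact tsum_congr fun g ↦ by by_cases hg : g • x ∈ s <;> simp [hg, hinv]
    _ = {g : G | g • x ∈ s}.encard * F x := by rw [← tsum_subtype, ENNReal.tsum_set_const]

theorem setLIntegral_le_mul_setLIntegral (hD : IsFundamentalDomain G D μ)
    (hs : MeasurableSet s) {F : X → ℝ≥0∞} (hF : Measurable F)
    (hinv : ∀ (g : G) x, F (g • x) = F x) {N : ℕ} (hN : ∀ x, {g : G | g • x ∈ s}.encard ≤ N) :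
    ∫⁻ x in s, F x ∂μ ≤ N * ∫⁻ x in D, F x ∂μ := by
  rw [setLIntegral_eq_setLIntegral_encard_mul hD hs hF hinv, ← lintegral_const_mul _ hF]
  gcongr with x
  exact_mod_cast hN x

theorem measure_fundamentalDomain_le (hD : IsFundamentalDomain G D μ)
    (hs : MeasurableSet s) (hmeet : ∀ x, ∃ g : G, g • x ∈ s) : μ D ≤ μ s := by
  rw [← setLIntegral_one, ← setLIntegral_one,
    setLIntegral_eq_setLIntegral_encard_mul hD hs measurable_const fun _ _ ↦ rfl]
  gcongr with x
  rw [mul_one]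
  exact_mod_cast one_le_encard_iff_nonempty.mpr (hmeet x)

end Unfolding

theorem exists_isFundamentalDomain_of_properlyDiscontinuousSMul {G X : Type*} [Group G]
    [MulAction G X] [MetricSpace X] [ProperSpace X] [Nonempty X] [ProperlyDiscontinuousSMul G X]
    [MeasurableSpace X] [BorelSpace X] [MeasurableConstSMul G X] {μ : Measure X}
    [SMulInvariantMeasure G X μ] (hfix : ∀ g : G, g ≠ 1 → μ (MulAction.fixedBy X g) = 0) :
    ∃ D, IsFundamentalDomain G D μ := by
  have := countable_of_properlyDiscontinuousSMul G X
  let x₀ : X := Classical.arbitrary X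
  obtain ⟨φ, hφ⟩ := exists_measurableEmbedding_real X
  let ψ (x : X) : ℝ ×ₗ ℝ := toLex (dist x x₀, φ x)
  have hψ : Function.Injective ψ := fun x y h ↦ hφ.injective (congrArg (fun p ↦ (ofLex p).2) h)
  have hmeas (g : G) : MeasurableSet {x | ψ x ≤ ψ (g • x)} := by
    have hg : Measurable fun x : X ↦ g • x := measurable_const_smul g
    have hdist : Measurable fun x : X ↦ dist x x₀ := measurable_id.dist measurable_const
    simp only [ψ, Prod.Lex.toLex_le_toLex]
    exact (measurableSet_lt hdist (hdist.comp hg)).union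
      ((measurableSet_eq_fun hdist (hdist.comp hg)).inter
        (measurableSet_le hφ.measurable (hφ.measurable.comp hg)))
  refine ⟨⋂ g : G, {x | ψ x ≤ ψ (g • x)}, .mk'' (.iInter fun g ↦ (hmeas g).nullMeasurableSet)
    (.of_forall fun x ↦ ?_) (fun g hg ↦ ?_)
    fun g ↦ (measurePreserving_smul g μ).quasiMeasurePreserving⟩
  · obtain ⟨g₁, hg₁, hmin⟩ := exists_min_image _ (fun g : G ↦ ψ (g • x))
      (finite_setOf_smul_mem_closedBall x x₀ (dist x x₀)) ⟨1, by simp⟩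
    refine ⟨g₁, mem_iInter.mpr fun g ↦ ?_⟩
    rw [mem_ofPred_eq, ← mul_smul]
    by_cases hg : (g * g₁) • x ∈ closedBall x₀ (dist x x₀)
    · exact hmin _ hg
    · exact Prod.Lex.toLex_le_toLex.mpr (.inl (lt_of_le_of_lt hg₁ (not_le.mp hg)))
  · refine measure_mono_null ?_ (hfix g hg)
    rintro _ ⟨⟨x, hx, rfl⟩, hgx⟩
    have hle : ψ x ≤ ψ (g • x) := mem_iInter.mp hx g
    have hge : ψ (g • x) ≤ ψ x := by simpa using mem_iInter.mp hgx g⁻¹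
    exact congrArg (g • ·) (hψ (hge.antisymm hle))

end FundamentalDomain

section MeanValue

variable {E : Type*} [NormedAddCommGroup E] [NormedSpace ℂ E] [CompleteSpace E] {f : ℂ → E}
  {c : ℂ} {r : ℝ}

theorem enorm_mul_le_lintegral_circleMap (hf : DiffContOnCl ℂ f (ball c |r|)) :
    ‖f c‖ₑ * ENNReal.ofReal (2 * π) ≤ ∫⁻ θ in Ioo (-π) π, ‖f (circleMap c r θ)‖ₑ := by
  have hmean : (2 * π) • f c = ∫ θ in Ioc (-π) π, f (circleMap c r θ) := by
    rw [← hf.circleAverage, Real.circleAverage_eq_integral_add (-π),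
      intervalIntegral.integral_comp_add_right (fun θ ↦ f (circleMap c r θ)),
      smul_inv_smul₀ (by positivity), ← intervalIntegral.integral_of_le (by linarith [Real.pi_pos])]
    ring_nf
  calc ‖f c‖ₑ * ENNReal.ofReal (2 * π) = ‖(2 * π) • f c‖ₑ := by
        rw [enorm_smul, mul_comm, Real.enorm_of_nonneg (by positivity)]
    _ ≤ ∫⁻ θ in Ioo (-π) π, ‖f (circleMap c r θ)‖ₑ := by
        rw [hmean, restrict_Ioo_eq_restrict_Ioc]
        exact enorm_integral_le_lintegral_enorm _

theorem lintegral_eq_lintegral_circleMap {F : ℂ → ℝ≥0∞} (hF : Measurable F) (c : ℂ) :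
    ∫⁻ z, F z = ∫⁻ ρ in Ioi 0, ENNReal.ofReal ρ * ∫⁻ θ in Ioo (-π) π, F (circleMap c ρ θ) := by
  have hpolar (p : ℝ × ℝ) : c + Complex.polarCoord.symm p = circleMap c p.1 p.2 := by
    rw [Complex.polarCoord_symm_apply, circleMap, Complex.exp_mul_I]
    push_cast; rfl
  have hmeas : Measurable fun p : ℝ × ℝ ↦ ENNReal.ofReal p.1 * F (circleMap c p.1 p.2) := by
    have hmap : Measurable fun p : ℝ × ℝ ↦ circleMap c p.1 p.2 := by unfold circleMap; fun_prop
    exact (measurable_fst.ennreal_ofReal).mul (hF.comp hmap)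
  rw [← lintegral_add_left_eq_self F c, ← Complex.lintegral_comp_polarCoord_symm]
  simp only [hpolar, smul_eq_mul]
  rw [polarCoord_target, Measure.volume_eq_prod, ← Measure.prod_restrict,
    lintegral_prod _ hmeas.aemeasurable]
  simp only [lintegral_const_mul' _ _ ENNReal.ofReal_ne_top]

theorem lintegral_ofReal_Ioo_zero (hr : 0 ≤ r) :
    ∫⁻ ρ in Ioo 0 r, ENNReal.ofReal ρ = ENNReal.ofReal (r ^ 2 / 2) := by
  have hint : IntegrableOn (fun ρ : ℝ ↦ ρ) (Ioc 0 r) := intervalIntegral.intervalIntegrable_id.1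
  have hpos : ∀ᵐ ρ ∂volume.restrict (Ioc 0 r), 0 ≤ ρ :=
    (ae_restrict_mem measurableSet_Ioc).mono fun ρ hρ ↦ hρ.1.le
  rw [restrict_Ioo_eq_restrict_Ioc, ← ofReal_integral_eq_lintegral_ofReal hint hpos,
    ← intervalIntegral.integral_of_le hr, integral_id, zero_pow two_ne_zero, sub_zero]

theorem enorm_mul_le_lintegral_ball (hr : 0 ≤ r) (hf : DifferentiableOn ℂ f (ball c r)) :
    ‖f c‖ₑ * ENNReal.ofReal (π * r ^ 2) ≤ ∫⁻ z in ball c r, ‖f z‖ₑ := by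
  let F : ℂ → ℝ≥0∞ := (ball c r).indicator (‖f ·‖ₑ)
  have hF : Measurable F := by
    classical
    rw [show F = (ball c r).piecewise (‖f ·‖ₑ) 0 from (piecewise_eq_indicator ..).symm]
    exact hf.continuousOn.enorm.measurable_piecewise continuousOn_const measurableSet_ball
  have hcircle : ∀ ρ ∈ Ioo 0 r,
      ‖f c‖ₑ * ENNReal.ofReal (2 * π) ≤ ∫⁻ θ in Ioo (-π) π, F (circleMap c ρ θ) := by
    rintro ρ ⟨hρ, hρr⟩
    have hdiff : DiffContOnCl ℂ f (ball c |ρ|) := by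
      refine (hf.mono (closure_ball_subset_closedBall.trans ?_)).diffContOnCl
      exact closedBall_subset_ball ((abs_of_pos hρ).trans_lt hρr)
    refine (enorm_mul_le_lintegral_circleMap hdiff).trans_eq (lintegral_congr fun θ ↦ ?_)
    have hmem : circleMap c ρ θ ∈ ball c r := by simpa [circleMap, abs_of_pos hρ] using hρr
    exact (indicator_of_mem hmem (‖f ·‖ₑ)).symm
  calc ‖f c‖ₑ * ENNReal.ofReal (π * r ^ 2)
      = ∫⁻ ρ in Ioo 0 r, ENNReal.ofReal ρ * (‖f c‖ₑ * ENNReal.ofReal (2 * π)) := by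
        rw [lintegral_mul_const _ (by fun_prop), lintegral_ofReal_Ioo_zero hr, mul_left_comm,
          ← ENNReal.ofReal_mul (by positivity)]
        ring_nf
    _ ≤ ∫⁻ ρ in Ioo 0 r, ENNReal.ofReal ρ * ∫⁻ θ in Ioo (-π) π, F (circleMap c ρ θ) := by
        refine setLIntegral_mono' measurableSet_Ioo fun ρ hρ ↦ ?_
        gcongr
        exact hcircle ρ hρ
    _ ≤ ∫⁻ ρ in Ioi 0, ENNReal.ofReal ρ * ∫⁻ θ in Ioo (-π) π, F (circleMap c ρ θ) :=
        lintegral_mono_set Ioo_subset_Ioi_self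
    _ = ∫⁻ z in ball c r, ‖f z‖ₑ := by
        rw [← lintegral_eq_lintegral_circleMap hF, lintegral_indicator measurableSet_ball]

end MeanValue

section OrthonormalFamilies

variable {𝕜 V : Type*} [RCLike 𝕜] [NormedAddCommGroup V] [InnerProductSpace 𝕜 V] {C : ℝ}

theorem sum_norm_apply_sq_le_of_orthonormal {ι : Type*} [Fintype ι] {f : ι → V}
    (hf : Orthonormal 𝕜 f) {ℓ : V →ₗ[𝕜] 𝕜} (hC : 0 ≤ C) (hℓ : ∀ v, ‖ℓ v‖ ^ 2 ≤ C * ‖v‖ ^ 2) :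
    ∑ j, ‖ℓ (f j)‖ ^ 2 ≤ C := by
  set s := ∑ j, ‖ℓ (f j)‖ ^ 2 with hs
  set v := ∑ j, (starRingEnd 𝕜) (ℓ (f j)) • f j with hv
  have hs_nonneg : 0 ≤ s := Finset.sum_nonneg fun _ _ ↦ sq_nonneg _
  have happly : ℓ v = (s : 𝕜) := by
    simp only [hv, hs, map_sum, map_smul, smul_eq_mul, RCLike.conj_mul, RCLike.ofReal_pow]
  have hnorm : ‖v‖ ^ 2 = s := by
    rw [← inner_self_eq_norm_sq (𝕜 := 𝕜), hv, hf.inner_sum, hs, map_sum]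
    simp only [RCLike.conj_conj, RCLike.mul_conj, ← RCLike.ofReal_pow, RCLike.ofReal_re]
  have hsq : s * s ≤ C * s := by
    simpa only [happly, hnorm, RCLike.norm_ofReal, sq_abs, sq s] using hℓ v
  rcases hs_nonneg.eq_or_lt with hzero | hpos
  · exact hzero ▸ hC
  · exact le_of_mul_le_mul_right hsq hpos

theorem finiteDimensional_of_forall_orthonormal_le (N : ℕ)
    (hN : ∀ (d : ℕ) (f : Fin d → V), Orthonormal 𝕜 f → d ≤ N) : FiniteDimensional 𝕜 V := by
  rw [FiniteDimensional, ← Module.rank_lt_aleph0_iff]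
  by_contra! hrank
  obtain ⟨v, hv⟩ :=
    exists_linearIndependent_of_le_rank ((Cardinal.natCast_le_aleph0 (n := N + 1)).trans hrank)
  exact N.lt_irrefl (hN _ _ (InnerProductSpace.gramSchmidtNormed_orthonormal (𝕜 := 𝕜) hv))

theorem finiteDimensional_of_norm_sq_eq_integral {X : Type*} [MeasurableSpace X] {μ : Measure X}
    [IsFiniteMeasure μ] (ev : X → V →ₗ[𝕜] 𝕜) (hC : 0 ≤ C)
    (hint : ∀ v, Integrable (fun x ↦ ‖ev x v‖ ^ 2) μ)
    (hnorm : ∀ v, ‖v‖ ^ 2 = ∫ x, ‖ev x v‖ ^ 2 ∂μ)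
    (hev : ∀ x v, ‖ev x v‖ ^ 2 ≤ C * ‖v‖ ^ 2) : FiniteDimensional 𝕜 V := by
  obtain ⟨N, hN⟩ := exists_nat_ge (C * μ.real univ)
  refine finiteDimensional_of_forall_orthonormal_le N fun d f hf ↦ Nat.cast_le (α := ℝ).mp ?_
  calc (d : ℝ) = ∑ j, ‖f j‖ ^ 2 := by simp [hf.norm_eq_one]
    _ = ∫ x, ∑ j, ‖ev x (f j)‖ ^ 2 ∂μ := by
        simp only [hnorm, integral_finsetSum _ fun j _ ↦ hint (f j)]
    _ ≤ ∫ _, C ∂μ :=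
        integral_mono (integrable_finsetSum _ fun j _ ↦ hint (f j)) (integrable_const C)
          fun x ↦ sum_norm_apply_sq_le_of_orthonormal hf hC (hev x)
    _ ≤ N := by rwa [integral_const, smul_eq_mul, mul_comm]

end OrthonormalFamilies

namespace Fuchsian

variable {Γ : Subgroup PSL(2, ℝ)}

section FuchsianAction

instance : ProperSMul PSL(2, ℝ) ℍ :=
  properSMul_of_isOpenQuotientMap (G := SL(2, ℝ)) QuotientGroup.isOpenQuotientMap_mk psl_mk_smul

instance : IsIsometricSMul PSL(2, ℝ) ℍ where
  isometry_smul := QuotientGroup.mk_surjective.forall.mpr fun g ↦ isometry_smul ℍ g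

instance : IsIsometricSMul Γ ℍ where
  isometry_smul γ := isometry_smul ℍ (γ : PSL(2, ℝ))

instance : SMulInvariantMeasure PSL(2, ℝ) ℍ volume where
  measure_preimage_smul := QuotientGroup.mk_surjective.forall.mpr fun g _ hs ↦
    measure_preimage_smul_of_nullMeasurableSet hs.nullMeasurableSet
      (Matrix.SpecialLinearGroup.mapGL ℝ g)

instance : T3Space PSL(2, ℝ) :=
  have := isClosed_center SL(2, ℝ)
  inferInstanceAs (T3Space (SL(2, ℝ) ⧸ Subgroup.center SL(2, ℝ)))

instance : IsTopologicalGroup PSL(2, ℝ) :=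
  inferInstanceAs (IsTopologicalGroup (SL(2, ℝ) ⧸ Subgroup.center SL(2, ℝ)))

theorem IsFuchsian.properlyDiscontinuousSMul (hΓ : IsFuchsian Γ) :
    ProperlyDiscontinuousSMul Γ ℍ := by
  have : DiscreteTopology Γ := hΓ
  have : IsClosed (Γ : Set PSL(2, ℝ)) := Subgroup.isClosed_of_discrete
  exact properlyDiscontinuousSMul_iff_properSMul.mpr inferInstance

theorem IsFuchsian.countable (hΓ : IsFuchsian Γ) : Countable Γ :=
  have := hΓ.properlyDiscontinuousSMul
  countable_of_properlyDiscontinuousSMul Γ ℍ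

theorem fixedBy_subsingleton {γ : PSL(2, ℝ)} (hγ : γ ≠ 1) :
    (MulAction.fixedBy ℍ γ).Subsingleton := by
  obtain ⟨g, rfl⟩ := QuotientGroup.mk_surjective γ
  let G : GL (Fin 2) ℝ := Matrix.SpecialLinearGroup.mapGL ℝ g
  have hG : G ∉ Subgroup.center (GL (Fin 2) ℝ) := by
    refine fun hcenter ↦ hγ ((QuotientGroup.eq_one_iff g).mpr (Subgroup.mem_center_iff.mpr ?_))
    refine fun h ↦ Matrix.SpecialLinearGroup.mapGL_injective (R := ℝ) (S := ℝ) ?_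
    simpa only [map_mul] using
      Subgroup.mem_center_iff.mp hcenter (Matrix.SpecialLinearGroup.mapGL ℝ h)
  have hdet : 0 < G.det.val := by simp [G]
  intro z (hz : G • z = z) w (hw : G • w = w)
  have hell := UpperHalfPlane.isElliptic_of_exists_smul_eq_self hdet hG ⟨z, hz⟩
  rw [UpperHalfPlane.gl_smul_eq_self_iff_eq_fixedPt hdet hell] at hz hw
  rw [hz, hw]

instance : NullSingletonClass (volume : Measure ℍ) where
  measure_singleton z := by
    rw [UpperHalfPlane.volume_eq_lintegral, image_singleton, Measure.restrict_singleton,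
      measure_singleton, zero_smul, lintegral_zero_measure]

theorem IsFuchsian.exists_isFundamentalDomain (hΓ : IsFuchsian Γ) :
    ∃ D : Set ℍ, IsFundamentalDomain Γ D volume :=
  have := hΓ.properlyDiscontinuousSMul
  exists_isFundamentalDomain_of_properlyDiscontinuousSMul fun γ hγ ↦
    (fixedBy_subsingleton (γ := (γ : PSL(2, ℝ))) (by simpa using hγ)).measure_zero _

theorem volume_fundamentalDomain_lt_top (hΓ : IsFuchsian Γ) (hc : IsCocompact Γ) {D : Set ℍ}
    (hD : IsFundamentalDomain Γ D volume) : volume D < ⊤ := by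
  have := hΓ.countable
  have : CompactSpace (MulAction.orbitRel.Quotient Γ ℍ) := hc
  obtain ⟨R, hR⟩ := exists_forall_exists_smul_mem_closedBall (G := Γ) UpperHalfPlane.I
  exact (measure_fundamentalDomain_le hD measurableSet_closedBall hR).trans_lt
    (isCompact_closedBall _ R).measure_lt_top

end FuchsianAction

section PointwiseEstimate

variable {n : ℕ} {f : ℍ → ℂ}

/-- The invariant square norm `|f(z)|² Im(z) ^ n` of a form `f` of weight `n`. -/
noncomputable def peterssonNormSq (n : ℕ) (f : ℍ → ℂ) (z : ℍ) : ℝ :=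
  ‖f z‖ ^ 2 * z.im ^ n

theorem peterssonNormSq_nonneg (n : ℕ) (f : ℍ → ℂ) (z : ℍ) : 0 ≤ peterssonNormSq n f z :=
  mul_nonneg (sq_nonneg _) (pow_nonneg z.im_pos.le n)

theorem continuous_peterssonNormSq (n : ℕ) (hf : Continuous f) :
    Continuous (peterssonNormSq n f) := by
  unfold peterssonNormSq
  fun_prop

theorem exp_sub_two_mul_sq_le {v : ℝ} (hv : -(1 / 2) ≤ v) : Real.exp (v - 2 * v ^ 2) ≤ 1 + v := by
  have hpos : 0 < 1 + v := by linarith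
  rw [← Real.le_log_iff_exp_le hpos]
  refine le_trans ?_ (Real.one_sub_inv_le_log_of_pos hpos)
  have hdiff : 1 - (1 + v)⁻¹ - (v - 2 * v ^ 2) = v ^ 2 * (1 + 2 * v) / (1 + v) := by
    field_simp; ring
  rw [← sub_nonneg, hdiff]
  exact div_nonneg (mul_nonneg (sq_nonneg v) (by linarith)) hpos.le

theorem exp_mul_le_exp_one_mul_one_add_pow {v : ℝ} (hv : -(1 / 2) ≤ v) (hn : 2 * n * v ^ 2 ≤ 1) :
    Real.exp (n * v) ≤ Real.exp 1 * (1 + v) ^ n :=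
  calc Real.exp (n * v) = Real.exp (2 * n * v ^ 2) * Real.exp (v - 2 * v ^ 2) ^ n := by
        rw [← Real.exp_nat_mul, ← Real.exp_add]
        ring_nf
    _ ≤ Real.exp 1 * (1 + v) ^ n := by
        gcongr
        exact exp_sub_two_mul_sq_le hv

theorem abs_im_sub_lt_of_mem_ball {z w : ℂ} {r : ℝ} (hz : z ∈ ball w r) : |z.im - w.im| < r :=
  (Complex.abs_im_le_norm (z - w)).trans_lt (mem_ball_iff_norm.mp hz)

theorem dist_le_one_of_dist_coe_le {z w : ℍ} (h : dist (z : ℂ) w ≤ w.im / 2) : dist z w ≤ 1 := by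
  have him : |z.im - w.im| ≤ w.im / 2 :=
    (Complex.abs_im_le_norm (z - w : ℂ)).trans (dist_eq_norm (z : ℂ) w ▸ h)
  refine (UpperHalfPlane.dist_le_dist_coe_div_sqrt z w).trans ?_
  rw [div_le_one (Real.sqrt_pos.mpr (mul_pos z.im_pos w.im_pos))]
  refine h.trans (Real.le_sqrt_of_sq_le ?_)
  nlinarith [(abs_le.mp him).1, w.im_pos]

theorem setLIntegral_upperHalfPlane {F : ℍ → ℝ≥0∞} (hF : Measurable F) {s : Set ℍ}
    (hs : MeasurableSet s) :
    ∫⁻ z in s, F z = ∫⁻ z in UpperHalfPlane.coe '' s,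
      ENNReal.ofReal (1 / z.im ^ 2) * F (UpperHalfPlane.ofComplex z) := by
  have hdensity : Measurable fun z : ℍ ↦ ((1 / NNReal.mk z.im z.im_pos.le : NNReal) ^ 2) := by
    refine Continuous.measurable (.pow (.div₀ continuous_const ?_ fun z ↦ ?_) 2)
    · exact UpperHalfPlane.continuous_im.subtype_mk _
    · exact NNReal.ne_iff.mp z.im_ne_zero
  have hcoe : MeasurePreserving UpperHalfPlane.coe (volume.comap UpperHalfPlane.coe)
      (volume.restrict (range UpperHalfPlane.coe)) :=
    ⟨UpperHalfPlane.measurable_coe, by rw [UpperHalfPlane.measurableEmbedding_coe.map_comap]⟩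
  rw [UpperHalfPlane.volume_def,
    setLIntegral_withDensity_eq_setLIntegral_mul _ hdensity.coe_nnreal_ennreal hF hs,
    ← Measure.restrict_restrict_of_subset (image_subset_range UpperHalfPlane.coe s),
    ← hcoe.setLIntegral_comp_emb UpperHalfPlane.measurableEmbedding_coe]
  refine lintegral_congr fun z ↦ ?_
  rw [Pi.mul_apply, UpperHalfPlane.ofComplex_apply, ← ENNReal.ofReal_coe_nnreal]
  simp

theorem setLIntegral_ball_coe_le {F : ℍ → ℝ≥0∞} (hF : Measurable F) {w : ℍ} {r : ℝ}
    (hr : r ≤ w.im / 2) :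
    ∫⁻ z in ball (w : ℂ) r, F (UpperHalfPlane.ofComplex z) ≤
      ENNReal.ofReal (9 / 4 * w.im ^ 2) * ∫⁻ z in closedBall w 1, F z := by
  have him {z : ℂ} (hz : z ∈ ball (w : ℂ) r) : |z.im - w.im| < w.im / 2 :=
    (abs_im_sub_lt_of_mem_ball hz).trans_le hr
  have hsub : ball (w : ℂ) r ⊆ UpperHalfPlane.coe '' closedBall w 1 := fun z hz ↦ by
    lift z to ℍ using by linarith [(abs_lt.mp (him hz)).1, w.im_pos]
    exact ⟨z, dist_le_one_of_dist_coe_le (hz.le.trans hr), rfl⟩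
  rw [setLIntegral_upperHalfPlane hF measurableSet_closedBall,
    ← lintegral_const_mul' _ _ ENNReal.ofReal_ne_top]
  refine (setLIntegral_mono' measurableSet_ball fun z hz ↦ ?_).trans (lintegral_mono_set hsub)
  obtain ⟨hlower, hupper⟩ := abs_lt.mp (him hz)
  have hpos : 0 < z.im := by linarith [w.im_pos]
  have hdensity : 1 ≤ 9 / 4 * w.im ^ 2 * (1 / z.im ^ 2) := by
    rw [mul_one_div, le_div_iff₀ (by positivity)]
    nlinarith
  rw [← mul_assoc, ← ENNReal.ofReal_mul (by positivity)]
  exact le_mul_of_one_le_left' (ENNReal.one_le_ofReal.mpr hdensity)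

/-- `f` times a nonvanishing holomorphic factor whose square absolute value is
`exp (n * (y - y₀) / y₀)`, where `y = Im z` and `y₀ = Im z₀`. This is the first-order approximation
at `z₀` of `(y / y₀) ^ n`, so near `z₀` the subharmonic function `‖twist n f z₀ z‖ ^ 2` is
comparable with the invariant square norm of `f`. -/
noncomputable def twist (n : ℕ) (f : ℍ → ℂ) (z₀ : ℍ) (z : ℂ) : ℂ :=
  f (UpperHalfPlane.ofComplex z) * Complex.exp (-(Complex.I * (n / (2 * z₀.im) : ℝ) * (z - z₀)))

theorem twist_coe_self (n : ℕ) (f : ℍ → ℂ) (z₀ : ℍ) : twist n f z₀ z₀ = f z₀ := by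
  simp [twist]

theorem norm_twist_sq (n : ℕ) (f : ℍ → ℂ) (z₀ z : ℍ) :
    ‖twist n f z₀ z‖ ^ 2 = ‖f z‖ ^ 2 * Real.exp (n * ((z.im - z₀.im) / z₀.im)) := by
  have hre (c : ℝ) : (-(Complex.I * c * (z - z₀ : ℂ))).re = c * (z.im - z₀.im) := by simp
  rw [twist, norm_mul, mul_pow, UpperHalfPlane.ofComplex_apply, Complex.norm_exp, hre,
    ← Real.exp_nat_mul]
  ring_nf

theorem differentiableOn_twist (n : ℕ) (hf : MDifferentiable 𝓘(ℂ) 𝓘(ℂ) f) (z₀ : ℍ) :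
    DifferentiableOn ℂ (twist n f z₀) {z | 0 < z.im} :=
  (UpperHalfPlane.mdifferentiable_iff.mp hf).mul (by fun_prop)

theorem im_pow_mul_norm_twist_sq_le (f : ℍ → ℂ) {z₀ z : ℍ} {r : ℝ}
    (hz : |z.im - z₀.im| ≤ r) (hhalf : r ≤ z₀.im / 2) (hn : 2 * n * r ^ 2 ≤ z₀.im ^ 2) :
    z₀.im ^ n * ‖twist n f z₀ z‖ ^ 2 ≤ Real.exp 1 * peterssonNormSq n f z := by
  have hpos := z₀.im_pos
  set v := (z.im - z₀.im) / z₀.im with hv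
  have him : z.im = z₀.im * (1 + v) := by rw [hv]; field_simp; ring
  have hv_lower : -(1 / 2) ≤ v := by rw [hv, le_div_iff₀ hpos]; linarith [(abs_le.mp hz).1]
  have hv_sq : 2 * n * v ^ 2 ≤ 1 := by
    rw [hv, div_pow, mul_div_assoc', div_le_one (by positivity), ← sq_abs (z.im - z₀.im)]
    exact le_trans (by gcongr) hn
  calc z₀.im ^ n * ‖twist n f z₀ z‖ ^ 2 = ‖f z‖ ^ 2 * z₀.im ^ n * Real.exp (n * v) := by
        rw [norm_twist_sq]; ring
    _ ≤ ‖f z‖ ^ 2 * z₀.im ^ n * (Real.exp 1 * (1 + v) ^ n) := by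
        gcongr
        exact exp_mul_le_exp_one_mul_one_add_pow hv_lower hv_sq
    _ = Real.exp 1 * peterssonNormSq n f z := by rw [peterssonNormSq, him, mul_pow]; ring

theorem ofReal_peterssonNormSq_mul_le (hf : MDifferentiable 𝓘(ℂ) 𝓘(ℂ) f) {z₀ : ℍ} {r : ℝ}
    (hr : 0 ≤ r) (hhalf : r ≤ z₀.im / 2) (hn : 2 * n * r ^ 2 ≤ z₀.im ^ 2) :
    ENNReal.ofReal (peterssonNormSq n f z₀) * ENNReal.ofReal (π * r ^ 2) ≤
      ENNReal.ofReal (Real.exp 1 * (9 / 4 * z₀.im ^ 2)) *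
        ∫⁻ z in closedBall z₀ 1, ENNReal.ofReal (peterssonNormSq n f z) := by
  have hpos {z : ℂ} (hz : z ∈ ball (z₀ : ℂ) r) : 0 < z.im := by
    linarith [(abs_lt.mp (abs_im_sub_lt_of_mem_ball hz)).1, z₀.coe_im, z₀.im_pos]
  have hmean := enorm_mul_le_lintegral_ball hr
    (((differentiableOn_twist n hf z₀).mono fun _ ↦ hpos).pow 2)
  have htwist : ∀ z ∈ ball (z₀ : ℂ) r, ENNReal.ofReal (z₀.im ^ n) * ‖twist n f z₀ z ^ 2‖ₑ ≤
      ENNReal.ofReal (Real.exp 1) *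
        ENNReal.ofReal (peterssonNormSq n f (UpperHalfPlane.ofComplex z)) := by
    intro z hz
    lift z to ℍ using hpos hz
    rw [← ofReal_norm, norm_pow, ← ENNReal.ofReal_mul (pow_pos z₀.im_pos n).le,
      ← ENNReal.ofReal_mul (Real.exp_pos 1).le, UpperHalfPlane.ofComplex_apply]
    exact ENNReal.ofReal_le_ofReal
      (im_pow_mul_norm_twist_sq_le f (abs_im_sub_lt_of_mem_ball hz).le hhalf hn)
  have hmeas : Measurable fun z ↦ ENNReal.ofReal (peterssonNormSq n f z) :=
    (continuous_peterssonNormSq n hf.continuous).measurable.ennreal_ofReal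
  calc ENNReal.ofReal (peterssonNormSq n f z₀) * ENNReal.ofReal (π * r ^ 2)
      = ENNReal.ofReal (z₀.im ^ n) *
          (‖twist n f z₀ z₀ ^ 2‖ₑ * ENNReal.ofReal (π * r ^ 2)) := by
        rw [twist_coe_self, peterssonNormSq, ENNReal.ofReal_mul (sq_nonneg _), ← ofReal_norm,
          norm_pow]
        ring
    _ ≤ ENNReal.ofReal (z₀.im ^ n) * ∫⁻ z in ball (z₀ : ℂ) r, ‖twist n f z₀ z ^ 2‖ₑ := by
        gcongr
        exact hmean
    _ ≤ ENNReal.ofReal (Real.exp 1) * ∫⁻ z in ball (z₀ : ℂ) r,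
          ENNReal.ofReal (peterssonNormSq n f (UpperHalfPlane.ofComplex z)) := by
        rw [← lintegral_const_mul' _ _ ENNReal.ofReal_ne_top,
          ← lintegral_const_mul' _ _ ENNReal.ofReal_ne_top]
        exact setLIntegral_mono' measurableSet_ball htwist
    _ ≤ ENNReal.ofReal (Real.exp 1 * (9 / 4 * z₀.im ^ 2)) *
          ∫⁻ z in closedBall z₀ 1, ENNReal.ofReal (peterssonNormSq n f z) := by
        rw [ENNReal.ofReal_mul (Real.exp_pos 1).le, mul_assoc]
        gcongr
        exact setLIntegral_ball_coe_le hmeas hhalf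

-- `y₀ / (2 √(n + 1))` is the scale on which `twist` stays comparable with `f`, and the reciprocal
-- of the area of a disc of this radius is the source of the linear growth in `n`.
theorem ofReal_peterssonNormSq_le (hf : MDifferentiable 𝓘(ℂ) 𝓘(ℂ) f) (z₀ : ℍ) :
    ENNReal.ofReal (peterssonNormSq n f z₀) ≤ ENNReal.ofReal (9 * Real.exp 1 / π * (n + 1)) *
      ∫⁻ z in closedBall z₀ 1, ENNReal.ofReal (peterssonNormSq n f z) := by
  have := z₀.im_pos
  set r := z₀.im / (2 * √(n + 1)) with hr
  have hr_sq : r ^ 2 = z₀.im ^ 2 / (4 * (n + 1)) := by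
    rw [hr, div_pow, mul_pow, Real.sq_sqrt (by positivity)]
    norm_num
  have hr_half : r ≤ z₀.im / 2 := by
    have : 1 ≤ √((n : ℝ) + 1) := Real.one_le_sqrt.mpr (by simp)
    rw [hr]
    gcongr
    linarith
  have hr_n : 2 * n * r ^ 2 ≤ z₀.im ^ 2 := by
    rw [hr_sq, mul_div_assoc', div_le_iff₀ (by positivity)]
    nlinarith [mul_nonneg n.cast_nonneg (sq_nonneg z₀.im)]
  have harea : 0 < π * r ^ 2 := by positivity
  refine (ENNReal.mul_le_mul_iff_left (ENNReal.ofReal_pos.mpr harea).ne'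
    ENNReal.ofReal_ne_top).mp ?_
  refine (ofReal_peterssonNormSq_mul_le hf (by positivity) hr_half hr_n).trans_eq ?_
  rw [mul_right_comm, ← ENNReal.ofReal_mul (by positivity), hr_sq]
  congr 2
  field_simp

end PointwiseEstimate

section Petersson

variable {k : ℕ} {D : Set ℍ}

theorem petersson_self (n : ℕ) (f : ℍ → ℂ) (z : ℍ) :
    UpperHalfPlane.petersson n f f z = (peterssonNormSq n f z : ℂ) := by
  rw [UpperHalfPlane.petersson, Complex.conj_mul', zpow_natCast, peterssonNormSq]
  push_cast; rfl

theorem continuous_cuspForm (f : CuspForms Γ k) : Continuous f :=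
  (CuspFormClass.holo f).continuous

theorem continuous_petersson (f g : CuspForms Γ k) :
    Continuous (UpperHalfPlane.petersson (2 * k : ℕ) f g) :=
  UpperHalfPlane.petersson_continuous _ (continuous_cuspForm f) (continuous_cuspForm g)

theorem petersson_smul (f g : CuspForms Γ k) (γ : Γ) (z : ℍ) :
    UpperHalfPlane.petersson (2 * k : ℕ) f g (γ • z) =
      UpperHalfPlane.petersson (2 * k : ℕ) f g z := by
  obtain ⟨γ, hγ⟩ := γ
  obtain ⟨A, rfl⟩ := QuotientGroup.mk_surjective γ
  have hA : Matrix.SpecialLinearGroup.toGL A ∈ matrixLift Γ := ⟨A, hγ, rfl⟩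
  push_cast
  exact SlashInvariantFormClass.petersson_smul hA

theorem peterssonNormSq_smul (f : CuspForms Γ k) (γ : Γ) (z : ℍ) :
    peterssonNormSq (2 * k) f (γ • z) = peterssonNormSq (2 * k) f z := by
  simpa only [petersson_self, Complex.ofReal_inj] using petersson_smul f f γ z

theorem peterssonInner_eq_integral_petersson (f g : CuspForms Γ k) :
    peterssonInner D f g = ∫ z in D, UpperHalfPlane.petersson (2 * k : ℕ) g f z := by
  simp only [peterssonInner, UpperHalfPlane.petersson, zpow_natCast, mul_comm (f _)]

theorem peterssonInner_self (f : CuspForms Γ k) :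
    peterssonInner D f f = (∫ z in D, peterssonNormSq (2 * k) f z : ℝ) := by
  simp only [peterssonInner_eq_integral_petersson, petersson_self, integral_complex_ofReal]

theorem integrableOn_petersson (hΓ : IsFuchsian Γ) (hc : IsCocompact Γ)
    (hD : IsFundamentalDomain Γ D volume) (f g : CuspForms Γ k) :
    IntegrableOn (UpperHalfPlane.petersson (2 * k : ℕ) f g) D := by
  have : CompactSpace (MulAction.orbitRel.Quotient Γ ℍ) := hc
  obtain ⟨B, hB⟩ := exists_forall_norm_le_of_smul_invariant (continuous_petersson f g)
    (petersson_smul f g)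
  exact Measure.integrableOn_of_bounded (volume_fundamentalDomain_lt_top hΓ hc hD).ne
    (continuous_petersson f g).aestronglyMeasurable (.of_forall hB)

theorem integrableOn_peterssonNormSq (hΓ : IsFuchsian Γ) (hc : IsCocompact Γ)
    (hD : IsFundamentalDomain Γ D volume) (f : CuspForms Γ k) :
    IntegrableOn (peterssonNormSq (2 * k) f) D := by
  have hre := (integrableOn_petersson hΓ hc hD f f).re
  simp only [petersson_self, RCLike.re_to_complex, Complex.ofReal_re] at hre
  exact hre

theorem exists_forall_peterssonNormSq_le (hΓ : IsFuchsian Γ) (hc : IsCocompact Γ) :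
    ∃ C : ℝ, 0 ≤ C ∧ ∀ (k : ℕ) (D : Set ℍ), IsFundamentalDomain Γ D volume →
      ∀ (f : CuspForms Γ k) (z : ℍ),
        peterssonNormSq (2 * k) f z ≤ C * (k + 1) * ∫ z in D, peterssonNormSq (2 * k) f z := by
  have := hΓ.countable
  have := hΓ.properlyDiscontinuousSMul
  have : CompactSpace (MulAction.orbitRel.Quotient Γ ℍ) := hc
  obtain ⟨N, hN⟩ := exists_forall_encard_smul_mem_closedBall_le Γ ℍ 1
  refine ⟨18 * Real.exp 1 / π * N, by positivity, fun k D hD f z ↦ ?_⟩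
  have hnonneg : 0 ≤ ∫ z in D, peterssonNormSq (2 * k) f z :=
    integral_nonneg (peterssonNormSq_nonneg (2 * k) f)
  have hmeas : Measurable fun z ↦ ENNReal.ofReal (peterssonNormSq (2 * k) f z) :=
    (continuous_peterssonNormSq (2 * k) (continuous_cuspForm f)).measurable.ennreal_ofReal
  rw [← ENNReal.ofReal_le_ofReal_iff (by positivity)]
  calc ENNReal.ofReal (peterssonNormSq (2 * k) f z)
      ≤ ENNReal.ofReal (9 * Real.exp 1 / π * ((2 * k : ℕ) + 1)) *
          ∫⁻ z in closedBall z 1, ENNReal.ofReal (peterssonNormSq (2 * k) f z) :=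
        ofReal_peterssonNormSq_le (CuspFormClass.holo f) z
    _ ≤ ENNReal.ofReal (9 * Real.exp 1 / π * (2 * (k + 1))) *
          (N * ∫⁻ z in D, ENNReal.ofReal (peterssonNormSq (2 * k) f z)) := by
        gcongr
        · push_cast; linarith
        · exact setLIntegral_le_mul_setLIntegral hD measurableSet_closedBall hmeas
            (fun γ w ↦ by rw [peterssonNormSq_smul]) fun w ↦ hN w z
    _ = ENNReal.ofReal (18 * Real.exp 1 / π * N * (k + 1) *
          ∫ z in D, peterssonNormSq (2 * k) f z) := by
        rw [← ofReal_integral_eq_lintegral_ofReal (integrableOn_peterssonNormSq hΓ hc hD f)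
          (.of_forall (peterssonNormSq_nonneg (2 * k) f)), ← ENNReal.ofReal_natCast,
          ← ENNReal.ofReal_mul (by positivity), ← ENNReal.ofReal_mul (by positivity)]
        ring_nf

end Petersson

section PeterssonSpace

variable {k : ℕ} {D : Set ℍ}

/-- The Petersson inner product, conjugate-linear in the first variable as Mathlib requires, whence
the exchange of the arguments of `peterssonInner`. -/
noncomputable abbrev peterssonCore (hΓ : IsFuchsian Γ) (hc : IsCocompact Γ)
    (hD : IsFundamentalDomain Γ D volume) (k : ℕ) :
    InnerProductSpace.Core ℂ (CuspForms Γ k) where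
  inner f g := peterssonInner D g f
  conj_inner_symm f g := by
    rw [peterssonInner, peterssonInner, ← integral_conj]
    congr with z
    simp only [map_mul, map_pow, Complex.conj_conj, Complex.conj_ofReal, mul_comm (g z)]
  re_inner_nonneg f := by
    rw [peterssonInner_self]
    exact integral_nonneg (peterssonNormSq_nonneg (2 * k) f)
  add_left f g h := by
    simp only [peterssonInner_eq_integral_petersson]
    rw [← integral_add (integrableOn_petersson hΓ hc hD f h)
      (integrableOn_petersson hΓ hc hD g h)]
    congr with z
    simp only [UpperHalfPlane.petersson, add_apply, map_add, add_mul]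
  smul_left f g c := by
    simp only [peterssonInner_eq_integral_petersson, ← integral_const_mul]
    congr with z
    simp only [UpperHalfPlane.petersson, smul_apply, smul_eq_mul, map_mul,
      mul_assoc]
  definite f hf := by
    rw [peterssonInner_self, Complex.ofReal_eq_zero] at hf
    obtain ⟨C, -, hC⟩ := exists_forall_peterssonNormSq_le hΓ hc
    ext z
    have hz : peterssonNormSq (2 * k) f z ≤ 0 := by
      simpa only [hf, mul_zero] using hC k D hD f z
    simpa using nonpos_of_mul_nonpos_left hz (pow_pos z.im_pos _)

/-- The space of cusp forms of weight `2k` with the Petersson inner product over the fundamental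
domain `D`. It is a type synonym indexed by the proofs that make this an inner product. -/
def PeterssonSpace (_hΓ : IsFuchsian Γ) (_hc : IsCocompact Γ)
    (_hD : IsFundamentalDomain Γ D volume) (k : ℕ) : Type :=
  CuspForms Γ k

namespace PeterssonSpace

variable (hΓ : IsFuchsian Γ) (hc : IsCocompact Γ) (hD : IsFundamentalDomain Γ D volume)

noncomputable instance : NormedAddCommGroup (PeterssonSpace hΓ hc hD k) :=
  (peterssonCore hΓ hc hD k).toNormedAddCommGroup

noncomputable instance : InnerProductSpace ℂ (PeterssonSpace hΓ hc hD k) :=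
  .ofCore (peterssonCore hΓ hc hD k).toCore

/-- The cusp form underlying a vector of `PeterssonSpace`. -/
noncomputable def toCuspForm {hΓ : IsFuchsian Γ} {hc : IsCocompact Γ}
    {hD : IsFundamentalDomain Γ D volume} : PeterssonSpace hΓ hc hD k ≃ₗ[ℂ] CuspForms Γ k :=
  .refl ℂ (CuspForms Γ k)

/-- Evaluation at `z`, normalized by `Im(z) ^ k` so that its square absolute value is
`peterssonNormSq`. -/
noncomputable def eval (k : ℕ) (z : ℍ) : PeterssonSpace hΓ hc hD k →ₗ[ℂ] ℂ where
  toFun f := (z.im : ℂ) ^ k * f.toCuspForm z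
  map_add' f g := by rw [map_add, add_apply, mul_add]
  map_smul' c f := by rw [map_smul, smul_apply, RingHom.id_apply, smul_eq_mul, smul_eq_mul,
    mul_left_comm]

variable {hΓ hc hD}

theorem norm_eval_sq (f : PeterssonSpace hΓ hc hD k) (z : ℍ) :
    ‖eval hΓ hc hD k z f‖ ^ 2 = peterssonNormSq (2 * k) f.toCuspForm z := by
  rw [eval, LinearMap.coe_mk, AddHom.coe_mk, norm_mul, norm_pow,
    Complex.norm_of_nonneg z.im_pos.le, peterssonNormSq]
  ring

theorem norm_sq_eq_integral (f : PeterssonSpace hΓ hc hD k) :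
    ‖f‖ ^ 2 = ∫ z in D, ‖eval hΓ hc hD k z f‖ ^ 2 :=
  calc ‖f‖ ^ 2 = (peterssonInner D f.toCuspForm f.toCuspForm).re :=
        (inner_self_eq_norm_sq (𝕜 := ℂ) f).symm
    _ = ∫ z in D, ‖eval hΓ hc hD k z f‖ ^ 2 := by
        simp only [peterssonInner_self, norm_eval_sq, Complex.ofReal_re]

theorem orthonormal_iff {ι : Type*} [DecidableEq ι] {f : ι → PeterssonSpace hΓ hc hD k} :
    Orthonormal ℂ f ↔
      ∀ i j, peterssonInner D (f i).toCuspForm (f j).toCuspForm = if i = j then 1 else 0 := by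
  refine orthonormal_iff_ite.trans (forall_comm.trans (forall₂_congr fun i j ↦ ?_))
  simp only [eq_comm (a := j)]
  rfl

theorem exists_forall_norm_eval_sq_le (hΓ : IsFuchsian Γ) (hc : IsCocompact Γ) :
    ∃ C : ℝ, 0 ≤ C ∧ ∀ (k : ℕ) (D : Set ℍ) (hD : IsFundamentalDomain Γ D volume) (z : ℍ)
      (f : PeterssonSpace hΓ hc hD k), ‖eval hΓ hc hD k z f‖ ^ 2 ≤ C * (k + 1) * ‖f‖ ^ 2 := by
  obtain ⟨C, hC, hle⟩ := exists_forall_peterssonNormSq_le hΓ hc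
  refine ⟨C, hC, fun k D hD z f ↦ ?_⟩
  simpa only [norm_sq_eq_integral, norm_eval_sq] using hle k D hD f.toCuspForm z

instance : FiniteDimensional ℂ (PeterssonSpace hΓ hc hD k) := by
  obtain ⟨C, hC, hle⟩ := exists_forall_norm_eval_sq_le hΓ hc
  have : IsFiniteMeasure (volume.restrict D) :=
    isFiniteMeasure_restrict.mpr (volume_fundamentalDomain_lt_top hΓ hc hD).ne
  refine finiteDimensional_of_norm_sq_eq_integral (eval hΓ hc hD k) (by positivity) (fun f ↦ ?_)
    norm_sq_eq_integral (hle k D hD)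
  simp only [norm_eval_sq]
  exact integrableOn_peterssonNormSq hΓ hc hD f.toCuspForm

end PeterssonSpace

theorem exists_isPeterssonONB (hΓ : IsFuchsian Γ) (hc : IsCocompact Γ)
    (hD : IsFundamentalDomain Γ D volume) (k : ℕ) :
    ∃ (d : ℕ) (f : Fin d → CuspForms Γ k), IsPeterssonONB D f := by
  let b := stdOrthonormalBasis ℂ (PeterssonSpace hΓ hc hD k)
  refine ⟨_, fun j ↦ (b j).toCuspForm, PeterssonSpace.orthonormal_iff.mp b.orthonormal, ?_⟩
  rw [← (b.toBasis.map PeterssonSpace.toCuspForm).span_eq]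
  congr with j

theorem exists_forall_supSum_le (hΓ : IsFuchsian Γ) (hc : IsCocompact Γ) :
    ∃ C : ℝ, 0 ≤ C ∧ ∀ (k : ℕ) (D : Set ℍ), IsFundamentalDomain Γ D volume →
      ∀ (d : ℕ) (f : Fin d → CuspForms Γ k), IsPeterssonONB D f →
        ∀ z, supSum f z ≤ C * (k + 1) := by
  obtain ⟨C, hC, hle⟩ := PeterssonSpace.exists_forall_norm_eval_sq_le hΓ hc
  refine ⟨C, hC, fun k D hD d f hf z ↦ ?_⟩
  let g (j : Fin d) : PeterssonSpace hΓ hc hD k := PeterssonSpace.toCuspForm.symm (f j)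
  have hg : Orthonormal ℂ g := PeterssonSpace.orthonormal_iff.mpr hf.orthonormal
  calc supSum f z = ∑ j, ‖PeterssonSpace.eval hΓ hc hD k z (g j)‖ ^ 2 := by
        simp only [PeterssonSpace.norm_eval_sq, g, LinearEquiv.apply_symm_apply]
        rfl
    _ ≤ C * (k + 1) := sum_norm_apply_sq_le_of_orthonormal hg (by positivity) (hle k D hD z)

end PeterssonSpace

end Fuchsian

theorem corollary4p3 (Γ : Subgroup PSL(2, ℝ)) (hΓ : Fuchsian.IsFuchsian Γ)
    (hcpt : Fuchsian.IsCocompact Γ) :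
    (∃ D : Set ℍ, IsFundamentalDomain Γ D volume) ∧
    ∃ C : ℝ, ∀ k : ℕ, 1 ≤ k → ∀ D : Set ℍ, IsFundamentalDomain Γ D volume →
      (∃ (d : ℕ) (f : Fin d → Fuchsian.CuspForms Γ k), Fuchsian.IsPeterssonONB D f) ∧
      ∀ (d : ℕ) (f : Fin d → Fuchsian.CuspForms Γ k), Fuchsian.IsPeterssonONB D f →
        BddAbove (Set.range (Fuchsian.supSum f)) ∧
          (⨆ z : ℍ, Fuchsian.supSum f z) ≤ C * k := by
  obtain ⟨C, hC, hle⟩ := Fuchsian.exists_forall_supSum_le hΓ hcpt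
  refine ⟨hΓ.exists_isFundamentalDomain, 2 * C, fun k hk D hD ↦
    ⟨Fuchsian.exists_isPeterssonONB hΓ hcpt hD k, fun d f hf ↦ ?_⟩⟩
  have hbound (z : ℍ) : Fuchsian.supSum f z ≤ 2 * C * k :=
    calc Fuchsian.supSum f z ≤ C * (k + 1) := hle k D hD d f hf z
      _ ≤ C * (k + k) := by gcongr; exact_mod_cast hk
      _ = 2 * C * k := by ring
  exact ⟨⟨2 * C * k, Set.forall_mem_range.mpr hbound⟩, ciSup_le hbound⟩
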